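/- Let $s\ge 2$ and let $K=K_{n_1,\dots,n_s}$ be the complete $s$-partite graph with parts $X_1,\dots,X_s$, where $|X_i|=n_i\ge 1$. Let $F$ be a spanning forest of $K$ with connected components $T_1,\dots,T_c$, and let $\tau_F(K)$ be the number of spanning trees of $K$ that contain all edges of $F$. Put $n=\sum_{i=1}^s n_i$, $n_{ip}=|X_i\cap V(T_p)|$, $m_p=|V(T_p)|$ and $\alpha_p=n\,m_p-\sum_{i=1}^s n_i n_{ip}$. For real $x\notin\{\alpha_1,\dots,\alpha_c\}$ let $Z(x)=I_s+Y(x)$, where $Y(x)$ is the $s\times s$ matrix with entries $$y_{ij}(x)=\sum_{p=1}^c\frac{n_{jp}(m_p-n_{ip})}{x-\alpha_p}.$$ Then every $\alpha_p$ is nonzero, so that $Z$ is defined and differentiable at $0$, and $$\tau_F(K_{n_1,\dots,n_s})=\frac1c\left(\prod_{p=1}^c\alpha_p\right)\operatorname{tr}\left(-\operatorname{adj}Z(0)\,\left.\frac{\mathrm{d}Z(x)}{\mathrm{d}x}\right|_{x=0}\right).$$ -/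

import Mathlib

/-- The vertex set of `K_{n_1,…,n_s}`: a vertex `⟨i, a⟩` lies in the part `X_i`, which has `n i`
elements. -/
abbrev MVert {s : ℕ} (n : Fin s → ℕ) : Type := Σ i : Fin s, Fin (n i)

/-- The complete multipartite graph `K_{n_1,…,n_s}`. -/
abbrev multipartite {s : ℕ} (n : Fin s → ℕ) : SimpleGraph (MVert n) :=
  SimpleGraph.completeMultipartiteGraph (fun i : Fin s => Fin (n i))

/-- `τ_H(G)`: the number of spanning trees of `G` that contain all edges of `H`. -/
noncomputable def tauContaining {V : Type*} (G H : SimpleGraph V) : ℕ :=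
  Set.ncard {T : SimpleGraph V | T ≤ G ∧ T.IsTree ∧ H ≤ T}

namespace MultipartiteForest

variable {s : ℕ} {n : Fin s → ℕ} (F : SimpleGraph (MVert n))

/-- `n_{ip} = |X_i ∩ V(T_p)|`, the components `T_p` being the connected components of `F`. -/
noncomputable def partCount (i : Fin s) (p : F.ConnectedComponent) : ℕ :=
  Set.ncard {v : MVert n | v.1 = i ∧ v ∈ p.supp}

/-- `m_p = |V(T_p)|`. -/
noncomputable def compOrder (p : F.ConnectedComponent) : ℕ := p.supp.ncard

/-- `α_p = n m_p - ∑ i, n_i n_{ip}`, where `n = ∑ i, n_i`. -/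
noncomputable def alpha (p : F.ConnectedComponent) : ℝ :=
  (∑ i, (n i : ℝ)) * (compOrder F p : ℝ) - ∑ i, (n i : ℝ) * (partCount F i p : ℝ)

/-- The `s × s` matrix `Y(x)` with entries `y_{ij} = ∑ p, n_{jp} (m_p - n_{ip}) / (x - α_p)`. -/
noncomputable def matY [Fintype F.ConnectedComponent] (x : ℝ) : Matrix (Fin s) (Fin s) ℝ :=
  Matrix.of fun i j => ∑ p : F.ConnectedComponent,
    ((partCount F j p : ℝ) * ((compOrder F p : ℝ) - (partCount F i p : ℝ))) / (x - alpha F p)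

/-- `Z(x) = I_s + Y(x)`. -/
noncomputable def matZ [Fintype F.ConnectedComponent] (x : ℝ) : Matrix (Fin s) (Fin s) ℝ :=
  1 + matY F x

end MultipartiteForest

/-- The entrywise derivative at `x₀` of a matrix-valued function of a real variable. -/
noncomputable def matrixDeriv {m : Type*} (A : ℝ → Matrix m m ℝ) (x₀ : ℝ) : Matrix m m ℝ :=
  Matrix.of fun i j => deriv (fun x => A x i j) x₀

/-! Contract every component of `F`. Spanning trees of `K` containing `F` become spanning trees of a
multigraph on `c` vertices with Laplacian `L = N Nᵀ`. By the matrix-tree theorem every principal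
minor of `L` of order `c - 1` is `τ_F(K)`, so the derivative of `det (x - L)` at `0` is `(-1) ^ (c -
1) * c * τ_F(K)`.

The adjacency matrix of `K` is all-ones minus one rank-one block per part. Hence `L = diag(α) - A B`
with inner dimension `s`, and `det (1 + A B) = det (1 + B A)` gives `det (x - L) = ∏ (x - α_p) * det
Z(x)`. Since `L` is singular and all `α_p > 0`, `det Z(0) = 0`; differentiating at `0` leaves only
`∏ (-α_p) * tr (adj Z(0) Z'(0))` by Jacobi's formula. Equating the two derivatives proves the claim.

The matrix-tree theorem itself comes from `factorial_mul_det_mul_transpose` and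
`det_contractedIncMatrix_sq`: squared maximal minors of the reduced incidence matrix detect
connectedness. -/

namespace Matrix

/-! ### Determinants and adjugates -/

/-- A Cauchy–Binet type formula, summed over all maps instead of subsets. -/
theorem factorial_mul_det_mul_transpose {m E R : Type*} [Fintype m] [DecidableEq m] [Fintype E]
    [CommRing R] (N : Matrix m E R) :
    ((Fintype.card m).factorial : R) * (N * Nᵀ).det = ∑ f : m → E, (N.submatrix id f).det ^ 2 := by
  classical
  have expand : (N * Nᵀ).det = ∑ f : m → E, (∏ i, N i (f i)) * (N.submatrix id f).det := by
    have hrow : N * Nᵀ = fun i => ∑ e, N i e • Nᵀ e := by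
      ext i j
      simp [Matrix.mul_apply, Finset.sum_apply]
    have h := (detRowAlternating (n := m) (R := R)).toMultilinearMap.map_sum
      (fun (i : m) (e : E) => N i e • Nᵀ e)
    change detRowAlternating (N * Nᵀ) = _
    rw [hrow]
    refine h.trans (Finset.sum_congr rfl fun f _ => ?_)
    rw [MultilinearMap.map_smul_univ, smul_eq_mul]
    congr 1
    rw [← det_transpose (N.submatrix id f)]
    rfl
  -- Reindexing `f` as `f ∘ σ` brings out the sign of `σ`; summing over all `σ` then assembles a
  -- second copy of the minor and accounts for the factorial.
  have perm : ∀ σ : Equiv.Perm m, (N * Nᵀ).det =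
      ∑ f : m → E, (Equiv.Perm.sign σ : R) * (∏ i, N (σ i) (f i)) * (N.submatrix id f).det := by
    intro σ
    rw [expand]
    refine Fintype.sum_equiv (Equiv.arrowCongr σ.symm (Equiv.refl E)) _ _ fun f => ?_
    have h1 : (N.submatrix id (f ∘ σ)).det = Equiv.Perm.sign σ * (N.submatrix id f).det := by
      rw [← det_permute' σ]
      rfl
    have h2 : ∏ i, N (σ i) (f (σ i)) = ∏ i, N i (f i) :=
      Equiv.prod_comp σ fun i => N i (f i)
    have h3 : ((Equiv.Perm.sign σ : ℤ) : R) * ((Equiv.Perm.sign σ : ℤ) : R) = 1 := by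
      rw [← Int.cast_mul, Int.units_coe_mul_self, Int.cast_one]
    have h4 : (Equiv.arrowCongr σ.symm (Equiv.refl E)) f = f ∘ σ := rfl
    rw [h4, h1]
    simp only [Function.comp_apply, h2]
    linear_combination (-(∏ i, N i (f i)) * (N.submatrix id f).det) * h3
  have key : ∑ _σ : Equiv.Perm m, (N * Nᵀ).det = ∑ f : m → E, (N.submatrix id f).det ^ 2 := by
    rw [Finset.sum_congr rfl fun σ _ => perm σ, Finset.sum_comm]
    refine Finset.sum_congr rfl fun f _ => ?_
    rw [← Finset.sum_mul, sq]
    congr 1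
    rw [det_apply']
    rfl
  rw [← key, Finset.sum_const, Finset.card_univ, Fintype.card_perm, nsmul_eq_mul]

/-- Jacobi's formula for the derivative of a determinant. -/
theorem hasDerivAt_det {m : Type*} [Fintype m] [DecidableEq m] {A : ℝ → Matrix m m ℝ}
    {A' : Matrix m m ℝ} {x : ℝ} (h : ∀ i j, HasDerivAt (fun t => A t i j) (A' i j) x) :
    HasDerivAt (fun t => (A t).det) (trace ((A x).adjugate * A')) x := by
  have hprod : ∀ σ : Equiv.Perm m, HasDerivAt (fun t => ∏ i, A t (σ i) i)
      (∑ i, (∏ j ∈ Finset.univ.erase i, A x (σ j) j) * A' (σ i) i) x := by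
    intro σ
    have := HasDerivAt.fun_finsetProd (u := Finset.univ) (f := fun i t => A t (σ i) i)
      (f' := fun i => A' (σ i) i) (x := x) fun i _ => h (σ i) i
    simpa [smul_eq_mul] using this
  have hdet : HasDerivAt (fun t => (A t).det) (∑ σ : Equiv.Perm m, (Equiv.Perm.sign σ : ℝ) *
      ∑ i, (∏ j ∈ Finset.univ.erase i, A x (σ j) j) * A' (σ i) i) x := by
    simp only [det_apply']
    exact HasDerivAt.fun_sum fun σ _ => (hprod σ).const_mul _
  convert hdet using 1
  -- Cramer's rule: each term of the trace is the determinant with one column differentiated.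
  have hcol : ∀ i, ((A x).adjugate * A') i i = ((A x).updateCol i fun k => A' k i).det := by
    intro i
    rw [← cramer_apply, cramer_eq_adjugate_mulVec]
    rfl
  simp only [trace, diag_apply, hcol, det_apply', Finset.mul_sum]
  rw [Finset.sum_comm]
  refine Finset.sum_congr rfl fun σ _ => Finset.sum_congr rfl fun i _ => ?_
  congr 1
  rw [← Finset.prod_erase_mul _ _ (Finset.mem_univ i)]
  congr 1
  · refine Finset.prod_congr rfl fun j hj => ?_
    rw [updateCol_ne (Finset.ne_of_mem_erase hj)]
  · rw [updateCol_self]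

/-- Replacing row `r` by a unit vector makes the matrix block triangular with a `1 × 1` block equal
to `1`. -/
theorem adjugate_diag_eq_det_submatrix {m R : Type*} [Fintype m] [DecidableEq m] [CommRing R]
    (A : Matrix m m R) (r : m) :
    A.adjugate r r = (A.submatrix (Subtype.val : {i // i ≠ r} → m) Subtype.val).det := by
  rw [adjugate_apply, twoBlockTriangular_det _ (fun i => i ≠ r)]
  · have h1 : (((A.updateRow r (Pi.single r 1)).toSquareBlockProp fun i => ¬ i ≠ r)).det = 1 := by
      let _ : Unique {i // ¬ i ≠ r} := ⟨⟨⟨r, by simp⟩⟩, fun i => Subtype.ext (by simpa using i.2)⟩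
      rw [det_unique]
      change A.updateRow r (Pi.single r 1) r r = 1
      simp
    rw [h1, mul_one]
    congr 1
    ext i j
    simp [toSquareBlockProp, updateRow_ne i.2]
  · intro i hi j hj
    obtain rfl : i = r := by simpa using hi
    simp [hj]

end Matrix

/-! ### Matrix-tree theorem for trees containing a forest -/

namespace SimpleGraph

variable {V : Type*}

/-- The handshake lemma in a tree; closure of `s` under adjacency makes induced degrees equal to
degrees in `F`. In degree form the count can be summed over components. -/
theorem sum_degree_add_two_of_isTree_induce [Fintype V] (F : SimpleGraph V) [DecidableRel F.Adj]
    (s : Set V) [Fintype s] (hs : (F.induce s).IsTree)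
    (hadj : ∀ {v w : V}, v ∈ s → F.Adj v w → w ∈ s) :
    ∑ v : s, F.degree v + 2 = 2 * Fintype.card s := by
  classical
  have h3 : ∀ v : s, (F.induce s).degree v = F.degree v := by
    intro v
    convert! degree_induce_of_neighborSet_subset (v := v) fun _ hw => hadj v.2 hw
  rw [← hs.card_edgeFinset, mul_add, ← sum_degrees_eq_twice_card_edges,
    Finset.sum_congr rfl fun v _ => h3 v]

theorem IsAcyclic.card_edgeSet_add_card_connectedComponent [Finite V] {F : SimpleGraph V}
    (hF : F.IsAcyclic) : F.edgeSet.ncard + Nat.card F.ConnectedComponent = Nat.card V := by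
  classical
  have := Fintype.ofFinite V
  have := Fintype.ofFinite F.ConnectedComponent
  have hcomp : ∀ p : F.ConnectedComponent,
      ∑ v : p.supp, F.degree v + 2 = 2 * Fintype.card p.supp := by
    intro p
    exact F.sum_degree_add_two_of_isTree_induce p.supp (hF.isTree_connectedComponent p)
      fun hv hvw => (p.mem_supp_congr_adj hvw).1 hv
  let e : (Σ p : F.ConnectedComponent, p.supp) ≃ V :=
    Equiv.sigmaFiberEquiv F.connectedComponentMk
  have hsum : ∑ v : V, F.degree v = ∑ p : F.ConnectedComponent, ∑ v : p.supp, F.degree v := by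
    rw [← Fintype.sum_sigma', ← Equiv.sum_comp e]
    rfl
  have hcard : Fintype.card V = ∑ p : F.ConnectedComponent, Fintype.card p.supp := by
    rw [← Fintype.card_sigma, Fintype.card_congr e]
  have h := F.sum_degrees_eq_twice_card_edges
  have htot := Finset.sum_congr (s₁ := Finset.univ) rfl fun p _ => hcomp p
  rw [Finset.sum_add_distrib, ← hsum, ← Finset.mul_sum, ← hcard, Finset.sum_const,
    Finset.card_univ, smul_eq_mul] at htot
  rw [Nat.card_eq_fintype_card, Nat.card_eq_fintype_card, ← coe_edgeFinset, Set.ncard_coe_finset]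
  omega

open Classical in
/-- The incidence matrix of the multigraph obtained from `G` by contracting the connected
components of `F`, with every edge oriented arbitrarily. -/
noncomputable def contractedIncMatrix (F G : SimpleGraph V) :
    Matrix F.ConnectedComponent (G.edgeSet \ F.edgeSet : Set (Sym2 V)) ℤ :=
  Matrix.of fun p e =>
    (if F.connectedComponentMk (Quot.out e.1).1 = p then 1 else 0) -
      (if F.connectedComponentMk (Quot.out e.1).2 = p then 1 else 0)

/-- The graph obtained from `F` by adding a family of edges of `G`. -/
def addEdges {ι : Type*} {F G : SimpleGraph V}
    (f : ι → (G.edgeSet \ F.edgeSet : Set (Sym2 V))) : SimpleGraph V :=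
  F ⊔ fromEdgeSet (Set.range fun i => (f i).1)

section addEdges

variable {ι : Type*} {F G : SimpleGraph V} (f : ι → (G.edgeSet \ F.edgeSet : Set (Sym2 V)))

theorem le_addEdges : F ≤ addEdges f := le_sup_left

theorem edgeSet_addEdges : (addEdges f).edgeSet = F.edgeSet ∪ Set.range fun i => (f i).1 := by
  rw [addEdges, edgeSet_sup, edgeSet_fromEdgeSet]
  congr 1
  refine sdiff_eq_left.2 (Set.disjoint_left.2 ?_)
  rintro _ ⟨i, rfl⟩ h
  exact G.not_isDiag_of_mem_edgeSet (f i).2.1 h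

theorem addEdges_le (hFG : F ≤ G) : addEdges f ≤ G := by
  rw [← edgeSet_subset_edgeSet, edgeSet_addEdges]
  refine Set.union_subset (edgeSet_subset_edgeSet.2 hFG) ?_
  rintro _ ⟨i, rfl⟩
  exact (f i).2.1

theorem addEdges_adj_out (i : ι) :
    (addEdges f).Adj (Quot.out (f i).1).1 (Quot.out (f i).1).2 := by
  rw [← mem_edgeSet, edgeSet_addEdges]
  right
  exact ⟨i, (Quot.out_eq (f i).1).symm⟩

/-- A function that is constant on the components of `F` and takes equal values at the two ends of
each added edge is constant along the edges of the enlarged graph. -/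
theorem eq_of_addEdges_adj {K : Type*} (w : F.ConnectedComponent → K)
    (hw : ∀ i, w (F.connectedComponentMk (Quot.out (f i).1).1) =
      w (F.connectedComponentMk (Quot.out (f i).1).2)) {a b : V} (hab : (addEdges f).Adj a b) :
    w (F.connectedComponentMk a) = w (F.connectedComponentMk b) := by
  rw [← mem_edgeSet, edgeSet_addEdges] at hab
  rcases hab with hab | ⟨i, hi⟩
  · rw [ConnectedComponent.sound (Adj.reachable hab)]
  · have h : s((Quot.out (f i).1).1, (Quot.out (f i).1).2) = s(a, b) :=
      (Quot.out_eq (f i).1).trans hi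
    rcases Sym2.eq_iff.1 h with ⟨h1, h2⟩ | ⟨h1, h2⟩
    · rw [← h1, ← h2, hw]
    · rw [← h1, ← h2, hw]

end addEdges

section

variable {F G : SimpleGraph V} [Fintype F.ConnectedComponent] [DecidableEq F.ConnectedComponent]

/-- Potentials on the contracted multigraph, normalized to vanish at `r`, against the incidence
matrix. -/
theorem vecMul_contractedIncMatrix {K ι : Type*} [Field K] (r : F.ConnectedComponent)
    (f : ι → (G.edgeSet \ F.edgeSet : Set (Sym2 V)))
    (w : F.ConnectedComponent → K) (hw : w r = 0) (i : ι) :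
    Matrix.vecMul (fun p : {p // p ≠ r} => w p)
      (((contractedIncMatrix F G).submatrix Subtype.val f).map (Int.castRingHom K)) i =
    w (F.connectedComponentMk (Quot.out (f i).1).1) -
      w (F.connectedComponentMk (Quot.out (f i).1).2) := by
  classical
  -- Deleting row `r` loses nothing because `w r = 0`.
  have key : ∀ c : F.ConnectedComponent,
      ∑ p : {p // p ≠ r}, w p * (if c = p then (1 : K) else 0) = w c := by
    intro c
    by_cases hc : c = r
    · subst hc
      rw [hw]
      refine Finset.sum_eq_zero fun p _ => ?_
      rw [if_neg (Ne.symm p.2), mul_zero]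
    · rw [Finset.sum_eq_single (⟨c, hc⟩ : {p // p ≠ r})]
      · simp
      · intro p _ hp
        rw [if_neg, mul_zero]
        rintro rfl
        exact hp rfl
      · simp
  rw [← key (F.connectedComponentMk (Quot.out (f i).1).1),
    ← key (F.connectedComponentMk (Quot.out (f i).1).2), ← Finset.sum_sub_distrib]
  refine Finset.sum_congr rfl fun p _ => ?_
  rw [← mul_sub]
  simp [contractedIncMatrix]

/-- A left null vector, extended by `0` at `r`, is a potential constant along the edges of `addEdges
f`. A nonzero one exists exactly when some vertex is not joined to `r`. The field is arbitrary so
that `ZMod p` and `ℚ` can both be used. -/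
theorem det_contractedIncMatrix_ne_zero_iff (K : Type*) [Field K] (r : F.ConnectedComponent)
    (f : {p // p ≠ r} → (G.edgeSet \ F.edgeSet : Set (Sym2 V))) :
    (((contractedIncMatrix F G).submatrix Subtype.val f).det : K) ≠ 0 ↔
      (addEdges f).Connected := by
  classical
  have hmap : (((contractedIncMatrix F G).submatrix Subtype.val f).det : K) =
      (((contractedIncMatrix F G).submatrix Subtype.val f).map (Int.castRingHom K)).det :=
    (Int.castRingHom K).map_det _
  rw [hmap, Ne, ← Matrix.exists_vecMul_eq_zero_iff, not_iff_comm]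
  obtain ⟨v₀, hv₀⟩ := r.exists_rep
  change F.connectedComponentMk v₀ = r at hv₀
  constructor
  · intro hconn
    have : ∃ x, ¬ (addEdges f).Reachable x v₀ := by
      by_contra! h
      exact hconn (connected_iff _ |>.2 ⟨fun a b => (h a).trans (h b).symm, ⟨v₀⟩⟩)
    obtain ⟨x, hx⟩ := this
    -- The indicator of the component of `x` in the enlarged graph, which misses `r`.
    let w : F.ConnectedComponent → K := fun p =>
      if p.map (Hom.ofLE (le_addEdges f)) = (addEdges f).connectedComponentMk x then 1 else 0
    have hwmk : ∀ a, w (F.connectedComponentMk a) =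
        if (addEdges f).Reachable a x then 1 else 0 := by
      intro a
      simp [w]
    have hwr : w r = 0 := by
      rw [← hv₀, hwmk, if_neg fun h => hx h.symm]
    refine ⟨fun p => w p, fun h0 => ?_, ?_⟩
    · have hne : F.connectedComponentMk x ≠ r := by
        rw [← hv₀]
        exact fun h => hx ((ConnectedComponent.exact h).mono (le_addEdges f))
      have := congrFun h0 ⟨_, hne⟩
      simp [hwmk] at this
    · ext i
      rw [vecMul_contractedIncMatrix r f w hwr i, hwmk, hwmk]
      have hadj := (addEdges_adj_out f i).reachable
      have : (addEdges f).Reachable (Quot.out (f i).1).1 x ↔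
          (addEdges f).Reachable (Quot.out (f i).1).2 x :=
        ⟨fun h => hadj.symm.trans h, fun h => hadj.trans h⟩
      simp [this]
  · rintro ⟨v, hv, hvM⟩ hconn
    let w : F.ConnectedComponent → K := fun p => if hp : p ≠ r then v ⟨p, hp⟩ else 0
    have hwr : w r = 0 := by simp [w]
    have hvw : v = fun p : {p // p ≠ r} => w p := by
      ext p
      simp [w, p.2]
    rw [hvw] at hvM
    have hedge : ∀ {a b : V}, (addEdges f).Adj a b →
        w (F.connectedComponentMk a) = w (F.connectedComponentMk b) := by
      refine eq_of_addEdges_adj f w fun i => ?_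
      rw [← sub_eq_zero, ← vecMul_contractedIncMatrix r f w hwr i, hvM, Pi.zero_apply]
    have hreach : ∀ a, w (F.connectedComponentMk a) = 0 := by
      intro a
      obtain ⟨p⟩ := hconn.preconnected a v₀
      have hwalk : ∀ {a b : V}, (addEdges f).Walk a b →
          w (F.connectedComponentMk a) = w (F.connectedComponentMk b) := by
        intro a b p
        induction p with
        | nil => rfl
        | cons h _ ih => exact (hedge h).trans ih
      rw [hwalk p, hv₀, hwr]
    refine hv ?_
    rw [hvw]
    ext p
    obtain ⟨a, ha⟩ := p.1.exists_rep
    exact ha ▸ hreach a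

-- In the connected case the integer determinant is nonzero modulo every prime, hence `±1`;
-- otherwise it vanishes over `ℚ`.
open Classical in
theorem det_contractedIncMatrix_sq (r : F.ConnectedComponent)
    (f : {p // p ≠ r} → (G.edgeSet \ F.edgeSet : Set (Sym2 V))) :
    ((contractedIncMatrix F G).submatrix Subtype.val f).det ^ 2 =
      if (addEdges f).Connected then 1 else 0 := by
  set d := ((contractedIncMatrix F G).submatrix Subtype.val f).det with hd
  split_ifs with h
  · have hunit : d.natAbs = 1 := by
      by_contra hne
      obtain ⟨p, hp, hpd⟩ := Nat.exists_prime_and_dvd hne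
      have : Fact p.Prime := ⟨hp⟩
      refine (det_contractedIncMatrix_ne_zero_iff (ZMod p) r f).2 h ?_
      convert! (ZMod.intCast_zmod_eq_zero_iff_dvd d p).2 (Int.natCast_dvd.2 hpd)
    rw [sq]
    exact Int.isUnit_mul_self (Int.isUnit_iff_natAbs_eq.2 hunit)
  · have := (not_iff_not.2 (det_contractedIncMatrix_ne_zero_iff ℚ r f)).2 h
    rw [not_not, Int.cast_eq_zero] at this
    have hd0 : d = 0 := by rw [hd]; convert! this
    rw [hd0]
    rfl

omit [Fintype F.ConnectedComponent] [DecidableEq F.ConnectedComponent] in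
theorem ncard_edgeSet_sdiff_add_one [Finite V] (hF : F.IsAcyclic) {T : SimpleGraph V}
    (hT : T.IsTree) (hFT : F ≤ T) :
    (T.edgeSet \ F.edgeSet).ncard + 1 = Nat.card F.ConnectedComponent := by
  have h1 := hF.card_edgeSet_add_card_connectedComponent
  have h2 := (isTree_iff_connected_and_card.1 hT).2
  have h3 := Set.ncard_sdiff_add_ncard_of_subset (edgeSet_subset_edgeSet.2 hFT)
  rw [Nat.card_coe_set_eq] at h2
  omega

-- At most `c - 1` edges are added to the `|V| - c` edges of `F`, so a connected result has the edge
-- count of a tree.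
omit [DecidableEq F.ConnectedComponent] in
theorem isTree_addEdges [Finite V] (hF : F.IsAcyclic) (r : F.ConnectedComponent)
    (f : {p // p ≠ r} → (G.edgeSet \ F.edgeSet : Set (Sym2 V)))
    (h : (addEdges f).Connected) : (addEdges f).IsTree := by
  classical
  refine isTree_iff_connected_and_card.2 ⟨h, le_antisymm ?_ h.card_vert_le_card_edgeSet_add_one⟩
  have h1 := hF.card_edgeSet_add_card_connectedComponent
  have h2 : Nat.card {p // p ≠ r} + 1 = Nat.card F.ConnectedComponent := by
    rw [Nat.card_eq_fintype_card, Nat.card_eq_fintype_card, Fintype.card_subtype_compl,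
      Fintype.card_subtype_eq]
    exact Nat.sub_add_cancel (Fintype.card_pos_iff.2 ⟨r⟩)
  have h3 : (Set.range fun i => (f i).1).ncard ≤ Nat.card {p // p ≠ r} := by
    rw [← Set.image_univ, ← Set.ncard_univ]
    exact Set.ncard_image_le
  have h4 := Set.ncard_union_le F.edgeSet (Set.range fun i => (f i).1)
  rw [← edgeSet_addEdges] at h4
  rw [Nat.card_coe_set_eq]
  omega

-- Each tree `T` arises from exactly `(c - 1)!` maps, the bijections onto the `c - 1` edges of `T`
-- outside `F`.
open Classical in
theorem card_filter_connected_addEdges [Fintype V] (hFG : F ≤ G) (hF : F.IsAcyclic)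
    (r : F.ConnectedComponent) :
    (Finset.univ.filter fun f : {p // p ≠ r} → (G.edgeSet \ F.edgeSet : Set (Sym2 V)) =>
      (addEdges f).Connected).card =
    (Fintype.card {p // p ≠ r}).factorial * tauContaining G F := by
  have hfin : {T : SimpleGraph V | T ≤ G ∧ T.IsTree ∧ F ≤ T}.Finite := Set.toFinite _
  rw [tauContaining, Set.ncard_eq_toFinset_card _ hfin,
    Finset.card_eq_sum_card_fiberwise (f := addEdges) (t := hfin.toFinset), mul_comm]
  · refine Finset.sum_const_nat fun T hT => ?_
    obtain ⟨hTG, hTree, hFT⟩ := hfin.mem_toFinset.1 hT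
    let A : Set (G.edgeSet \ F.edgeSet : Set (Sym2 V)) := {e | e.1 ∈ T.edgeSet}
    have hA : Fintype.card {p // p ≠ r} = Fintype.card A := by
      have h1 := ncard_edgeSet_sdiff_add_one hF hTree hFT
      have h2 : (T.edgeSet \ F.edgeSet).ncard = Fintype.card A := by
        rw [← Nat.card_eq_fintype_card, Nat.card_coe_set_eq,
          ← Set.ncard_image_of_injective A Subtype.val_injective]
        congr 1
        ext e
        constructor
        · exact fun he => ⟨⟨e, edgeSet_subset_edgeSet.2 hTG he.1, he.2⟩, he.1, rfl⟩
        · rintro ⟨e, he, rfl⟩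
          exact ⟨he, e.2.2⟩
      rw [Nat.card_eq_fintype_card] at h1
      rw [Fintype.card_subtype_compl, Fintype.card_subtype_eq]
      omega
    rw [← Fintype.card_equiv (Fintype.equivOfCardEq hA), ← Finset.card_univ]
    symm
    have hrange : ∀ g : {p // p ≠ r} ≃ A, addEdges (fun q => (g q).1) = T := by
      intro g
      rw [← edgeSet_inj, edgeSet_addEdges]
      ext e
      constructor
      · rintro (he | ⟨q, rfl⟩)
        · exact edgeSet_subset_edgeSet.2 hFT he
        · exact (g q).2
      · intro he
        by_cases heF : e ∈ F.edgeSet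
        · exact Or.inl heF
        · refine Or.inr ⟨g.symm ⟨⟨e, edgeSet_subset_edgeSet.2 hTG he, heF⟩, he⟩, ?_⟩
          simp
    refine Finset.card_bij (fun g _ q => (g q).1) ?_ ?_ ?_
    · intro g _
      simp only [Finset.mem_filter, Finset.mem_univ, true_and, hrange g, and_true]
      exact hTree.connected
    · intro g _ g' _ h
      exact Equiv.ext fun q => Subtype.ext (congrFun h q)
    · intro f hf
      have hfT : addEdges f = T := (Finset.mem_filter.1 hf).2
      have hmem : ∀ q, f q ∈ A := by
        intro q
        change (f q).1 ∈ T.edgeSet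
        rw [← hfT, edgeSet_addEdges]
        exact Or.inr ⟨q, rfl⟩
      have hbij : Function.Bijective fun q => (⟨f q, hmem q⟩ : A) := by
        rw [Fintype.bijective_iff_surjective_and_card]
        refine ⟨?_, hA⟩
        rintro ⟨e, he⟩
        change e.1 ∈ T.edgeSet at he
        rw [← hfT, edgeSet_addEdges] at he
        rcases he with he | ⟨q, hq⟩
        · exact absurd he e.2.2
        · exact ⟨q, Subtype.ext (Subtype.ext hq)⟩
      exact ⟨Equiv.ofBijective _ hbij, Finset.mem_univ _, rfl⟩
  · intro f hf
    have hconn := (Finset.mem_filter.1 hf).2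
    exact hfin.mem_toFinset.2
      ⟨addEdges_le f hFG, isTree_addEdges hF r f hconn, le_addEdges f⟩

/-- The matrix-tree theorem for the spanning trees containing a given forest. -/
theorem det_contracted_laplacian [Fintype V]
    [Fintype (G.edgeSet \ F.edgeSet : Set (Sym2 V))] (hFG : F ≤ G) (hF : F.IsAcyclic)
    (r : F.ConnectedComponent) :
    ((contractedIncMatrix F G * (contractedIncMatrix F G).transpose).submatrix
      (Subtype.val : {p // p ≠ r} → _) Subtype.val).det = (tauContaining G F : ℤ) := by
  classical
  have h := Matrix.factorial_mul_det_mul_transpose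
    ((contractedIncMatrix F G).submatrix (Subtype.val : {p // p ≠ r} → _) id)
  have h2 := card_filter_connected_addEdges hFG hF r
  have h3 : ((Fintype.card {p // p ≠ r}).factorial : ℤ) ≠ 0 := by
    exact_mod_cast Nat.factorial_ne_zero _
  refine mul_left_cancel₀ h3 (Eq.trans ?_ (h.trans ?_))
  · rfl
  · rw [← Nat.cast_mul, ← h2, Finset.card_filter, Nat.cast_sum]
    refine Finset.sum_congr (Finset.ext fun _ => by simp only [Finset.mem_univ]) fun f _ => ?_
    simp only [Matrix.submatrix_submatrix, Function.comp_id, Function.id_comp,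
      det_contractedIncMatrix_sq]
    split_ifs <;> simp

end

end SimpleGraph

/-! ### Entries and singularity of the contracted Laplacian -/

namespace SimpleGraph

variable {V : Type*} {F G : SimpleGraph V}

open Classical in
theorem sum_dart_edge [Fintype V] (G : SimpleGraph V) (h : Sym2 V → ℤ) :
    ∑ a, ∑ b, (if G.Adj a b then h s(a, b) else 0) = 2 * ∑ e ∈ G.edgeFinset, h e := by
  have h1 : ∑ a, ∑ b, (if G.Adj a b then h s(a, b) else 0) = ∑ d : G.Dart, h d.edge := by
    rw [← Fintype.sum_prod_type', ← Finset.sum_filter]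
    symm
    exact Finset.sum_bij' (fun d _ => (d.fst, d.snd)) (fun x hx => ⟨x, (Finset.mem_filter.1 hx).2⟩)
      (by simp) (by simp) (by simp) (by simp) (by intro d _; rfl)
  rw [h1, ← Finset.sum_fiberwise_of_maps_to (t := G.edgeFinset) (g := Dart.edge)
    (fun d _ => mem_edgeFinset.2 d.edge_mem), Finset.mul_sum]
  refine Finset.sum_congr rfl fun e he => ?_
  rw [Finset.sum_congr rfl fun d hd => by rw [(Finset.mem_filter.1 hd).2], Finset.sum_const,
    G.dart_edge_fiber_card e (mem_edgeFinset.1 he), nsmul_eq_mul]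
  rfl

open Classical in
/-- The Laplacian entries of the contracted multigraph, as sums over ordered pairs of vertices. -/
theorem two_mul_contractedIncMatrix_mul_transpose [Fintype V]
    [Fintype (G.edgeSet \ F.edgeSet : Set (Sym2 V))] (hFG : F ≤ G) (p q : F.ConnectedComponent) :
    2 * (contractedIncMatrix F G * (contractedIncMatrix F G).transpose) p q =
      ∑ a, ∑ b, if G.Adj a b then
        ((if F.connectedComponentMk a = p then 1 else 0) -
          (if F.connectedComponentMk b = p then 1 else 0)) *
        ((if F.connectedComponentMk a = q then 1 else 0) -
          (if F.connectedComponentMk b = q then 1 else 0)) else 0 := by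
  let φ : V → F.ConnectedComponent → ℤ := fun a p => if F.connectedComponentMk a = p then 1 else 0
  let g : V × V → ℤ := fun x => (φ x.1 p - φ x.2 p) * (φ x.1 q - φ x.2 q)
  -- Swapping the ends changes the sign of both factors of `g`, so the orientation chosen by
  -- `Quot.out` is irrelevant.
  have hg : ∀ a b, g (Quot.out s(a, b)) = g (a, b) := by
    intro a b
    have h : s((Quot.out s(a, b)).1, (Quot.out s(a, b)).2) = s(a, b) := Quot.out_eq s(a, b)
    rcases Sym2.eq_iff.1 h with ⟨h1, h2⟩ | ⟨h1, h2⟩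
    · simp only [g, h1, h2]
    · simp only [g, h1, h2]
      ring
  have h1 := sum_dart_edge G fun e => g (Quot.out e)
  simp only [hg] at h1
  refine Eq.trans ?_ h1.symm
  congr 1
  -- Edges of `F` become loops under contraction and contribute nothing, so the sum may run over all
  -- of `G`.
  have hF : ∀ e ∈ F.edgeFinset, g (Quot.out e) = 0 := by
    intro e he
    have hadj : F.Adj (Quot.out e).1 (Quot.out e).2 := by
      rw [← mem_edgeSet]
      have h : s((Quot.out e).1, (Quot.out e).2) = e := Quot.out_eq e
      rw [h]
      exact mem_edgeFinset.1 he
    have := ConnectedComponent.sound hadj.reachable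
    simp only [g, φ, this, sub_self, zero_mul]
  have h2 : ∑ e ∈ G.edgeFinset, g (Quot.out e) =
      ∑ e ∈ G.edgeFinset \ F.edgeFinset, g (Quot.out e) := by
    rw [← Finset.sum_sdiff (edgeFinset_subset_edgeFinset.2 hFG), Finset.sum_eq_zero hF, add_zero]
  rw [h2, Matrix.mul_apply]
  exact (Finset.sum_subtype (G.edgeFinset \ F.edgeFinset) (by simp) fun e => g (Quot.out e)).symm

-- Every column of the incidence matrix sums to zero, so the all-ones vector is a left null vector.
open Classical in
theorem det_contractedIncMatrix_mul_transpose [Fintype F.ConnectedComponent]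
    [Fintype (G.edgeSet \ F.edgeSet : Set (Sym2 V))]
    [Nonempty V] : (contractedIncMatrix F G * (contractedIncMatrix F G).transpose).det = 0 := by
  rw [← Matrix.exists_vecMul_eq_zero_iff]
  obtain ⟨v⟩ := ‹Nonempty V›
  refine ⟨fun _ => 1, fun h => one_ne_zero (congrFun h (F.connectedComponentMk v)), ?_⟩
  rw [← Matrix.vecMul_vecMul]
  have h0 : Matrix.vecMul (fun _ => 1) (contractedIncMatrix F G) = 0 := by
    ext e
    simp only [Matrix.vecMul, dotProduct, contractedIncMatrix, Matrix.of_apply, one_mul,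
      Finset.sum_sub_distrib, Finset.sum_ite_eq, Finset.mem_univ, if_true, Pi.zero_apply, sub_self]
  rw [h0, Matrix.zero_vecMul]

end SimpleGraph

/-! ### The complete multipartite case: reduction to an `s × s` determinant -/

namespace MultipartiteForest

open SimpleGraph

variable {s : ℕ} {n : Fin s → ℕ} (F : SimpleGraph (MVert n))

open Classical in
theorem partCount_eq_sum (i : Fin s) (p : F.ConnectedComponent) :
    (partCount F i p : ℝ) = ∑ v : MVert n,
      (if v.1 = i then 1 else 0) * (if F.connectedComponentMk v = p then 1 else 0) := by
  rw [partCount, Set.ncard_eq_toFinset_card', Set.toFinset_ofPred, Finset.card_filter, Nat.cast_sum]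
  refine Finset.sum_congr rfl fun v _ => ?_
  by_cases h1 : v.1 = i <;> by_cases h2 : F.connectedComponentMk v = p <;> simp [ConnectedComponent.mem_supp_iff, h1, h2]

open Classical in
theorem compOrder_eq_sum (p : F.ConnectedComponent) :
    (compOrder F p : ℝ) = ∑ v : MVert n, (if F.connectedComponentMk v = p then 1 else 0) := by
  rw [compOrder, ConnectedComponent.supp, Set.ncard_eq_toFinset_card', Set.toFinset_ofPred,
    Finset.card_filter, Nat.cast_sum]
  refine Finset.sum_congr rfl fun v _ => ?_
  split_ifs <;> simp

theorem sum_partCount (p : F.ConnectedComponent) :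
    ∑ i, (partCount F i p : ℝ) = compOrder F p := by
  classical
  simp only [partCount_eq_sum, compOrder_eq_sum]
  rw [Finset.sum_comm]
  simp

open Classical in
theorem adj_indicator (a b : MVert n) : (if (multipartite n).Adj a b then (1 : ℝ) else 0) =
    1 - ∑ i, (if a.1 = i then 1 else 0) * (if b.1 = i then 1 else 0) := by
  simp only [ite_mul, one_mul, zero_mul, Finset.sum_ite_eq, Finset.mem_univ, if_true]
  by_cases h : a.1 = b.1
  · simp [h]
  · simp [h, Ne.symm h]

-- Adjacency is all-ones minus one rank-one block per part, so the bilinear form splits into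
-- products of sums.
open Classical in
theorem sum_adj (u v : MVert n → ℝ) :
    ∑ a, ∑ b, (if (multipartite n).Adj a b then (1 : ℝ) else 0) * (u a * v b) =
      (∑ a, u a) * (∑ b, v b) - ∑ i, (∑ a, (if a.1 = i then 1 else 0) * u a) *
        (∑ b, (if b.1 = i then 1 else 0) * v b) := by
  simp only [adj_indicator, sub_mul, one_mul, Finset.sum_sub_distrib, Finset.sum_mul_sum]
  congr 1
  symm
  rw [Finset.sum_comm]
  refine Finset.sum_congr rfl fun a _ => ?_
  rw [Finset.sum_comm]
  refine Finset.sum_congr rfl fun b _ => ?_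
  rw [Finset.sum_mul]
  exact Finset.sum_congr rfl fun i _ => by ring

open Classical in
/-- The Laplacian of the contracted graph is a diagonal matrix minus a matrix of rank at most
`s`. -/
theorem contracted_laplacian_eq [Fintype F.ConnectedComponent]
    [Fintype ((multipartite n).edgeSet \ F.edgeSet : Set (Sym2 (MVert n)))]
    (hF : F ≤ multipartite n) :
    (contractedIncMatrix F (multipartite n) *
      (contractedIncMatrix F (multipartite n)).transpose).map (Int.cast : ℤ → ℝ) =
    Matrix.diagonal (alpha F) -
      (Matrix.of fun (p : F.ConnectedComponent) (j : Fin s) => (partCount F j p : ℝ)) *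
      (Matrix.of fun (i : Fin s) (p : F.ConnectedComponent) =>
        (compOrder F p : ℝ) - (partCount F i p : ℝ)) := by
  ext p q
  let φ : F.ConnectedComponent → MVert n → ℝ := fun p a =>
    if F.connectedComponentMk a = p then 1 else 0
  let w : MVert n → MVert n → ℝ := fun a b => if (multipartite n).Adj a b then 1 else 0
  have hwsymm : ∀ a b, w a b = w b a := fun a b => by simp only [w, SimpleGraph.adj_comm]
  have h := congrArg (Int.cast : ℤ → ℝ) (two_mul_contractedIncMatrix_mul_transpose hF p q)
  -- Symmetry of `w` pairs the four products into a degree term and a cross term.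
  have h1 : (∑ a, ∑ b, w a b * ((φ p a - φ p b) * (φ q a - φ q b))) =
      2 * ((∑ a, ∑ b, w a b * ((φ p a * φ q a) * 1)) - ∑ a, ∑ b, w a b * (φ p a * φ q b)) := by
    have e1 : ∑ a, ∑ b, w a b * ((φ p b * φ q b) * 1) =
        ∑ a, ∑ b, w a b * ((φ p a * φ q a) * 1) := by
      rw [Finset.sum_comm]
      simp only [hwsymm]
    have e2 : ∑ a, ∑ b, w a b * (φ p b * φ q a) = ∑ a, ∑ b, w a b * (φ p a * φ q b) := by
      rw [Finset.sum_comm]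
      simp only [hwsymm]
    have e3 : ∑ a, ∑ b, w a b * ((φ p a - φ p b) * (φ q a - φ q b)) =
        ((∑ a, ∑ b, w a b * ((φ p a * φ q a) * 1)) - ∑ a, ∑ b, w a b * (φ p a * φ q b)) +
        ((∑ a, ∑ b, w a b * ((φ p b * φ q b) * 1)) - ∑ a, ∑ b, w a b * (φ p b * φ q a)) := by
      simp only [← Finset.sum_sub_distrib, ← Finset.sum_add_distrib]
      refine Finset.sum_congr rfl fun a _ => Finset.sum_congr rfl fun b _ => ?_
      ring
    rw [e3, e1, e2]
    ring
  have hφ : ∀ a, φ p a * φ q a = (if p = q then 1 else 0) * φ p a := by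
    intro a
    by_cases hpq : p = q
    · subst hpq
      simp [φ]
    · rw [if_neg hpq, zero_mul, mul_eq_zero]
      by_contra! hne
      have h1 : F.connectedComponentMk a = p := of_not_not fun h => hne.1 (if_neg h)
      have h2 : F.connectedComponentMk a = q := of_not_not fun h => hne.2 (if_neg h)
      exact hpq (h1.symm.trans h2)
  have hpart : ∀ i p, ∑ a, (if a.1 = i then 1 else 0) * φ p a = (partCount F i p : ℝ) :=
    fun i p => (partCount_eq_sum F i p).symm
  have hcomp : ∀ p, ∑ a, φ p a = (compOrder F p : ℝ) := fun p => (compOrder_eq_sum F p).symm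
  have hone : ∑ _b : MVert n, (1 : ℝ) = ∑ i, (n i : ℝ) := by simp
  have hn : ∀ i, ∑ b : MVert n, (if b.1 = i then (1 : ℝ) else 0) * 1 = n i := by
    intro i
    rw [Fintype.sum_sigma, Fintype.sum_eq_single i fun j hj => by simp [hj]]
    simp
  have h2 : ∑ a, ∑ b, w a b * ((φ p a * φ q a) * 1) = (if p = q then 1 else 0) * alpha F p := by
    rw [show (∑ a, ∑ b, w a b * ((φ p a * φ q a) * 1)) =
      (if p = q then 1 else 0) * ∑ a, ∑ b, w a b * (φ p a * 1) by
        simp only [Finset.mul_sum, hφ]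
        refine Finset.sum_congr rfl fun a _ => Finset.sum_congr rfl fun b _ => ?_
        ring, sum_adj, hcomp, hone]
    simp only [hpart, hn, alpha]
    congr 2
    · ring
    · exact Finset.sum_congr rfl fun i _ => mul_comm _ _
  -- Writing `m_p = ∑ i, n_{ip}` absorbs `m_p m_q` into the sum over parts, which keeps the inner
  -- dimension at `s`.
  have h3 : ∑ a, ∑ b, w a b * (φ p a * φ q b) =
      ∑ i, (partCount F i p : ℝ) * ((compOrder F q : ℝ) - partCount F i q) := by
    rw [sum_adj]
    simp only [hcomp, hpart, mul_sub, Finset.sum_sub_distrib]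
    rw [← Finset.sum_mul, sum_partCount]
  have h4 : (2 : ℝ) * ((contractedIncMatrix F (multipartite n) *
      (contractedIncMatrix F (multipartite n)).transpose) p q : ℤ) =
      ∑ a, ∑ b, w a b * ((φ p a - φ p b) * (φ q a - φ q b)) := by
    push_cast at h
    rw [h]
    refine Finset.sum_congr rfl fun a _ => Finset.sum_congr rfl fun b _ => ?_
    simp only [w, φ, ite_mul, one_mul, zero_mul]
  rw [h1, h2, h3] at h4
  rw [Matrix.map_apply, Matrix.sub_apply, mul_left_cancel₀ two_ne_zero h4,
    Matrix.diagonal_apply, Matrix.mul_apply]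
  simp

/-- Here `α_p = ∑ i, (n - n_i) n_{ip}`, the sum of the degrees in `K` of the vertices of `T_p`; with
two nonempty parts every such degree is positive. -/
theorem alpha_pos (hs : 2 ≤ s) (hn : ∀ i, 1 ≤ n i) (p : F.ConnectedComponent) :
    0 < alpha F p := by
  classical
  have h : alpha F p = ∑ i, ((∑ j, (n j : ℝ)) - n i) * partCount F i p := by
    simp only [alpha, ← sum_partCount, sub_mul, Finset.sum_sub_distrib, Finset.mul_sum]
  have hlt : ∀ i, 0 < (∑ j, (n j : ℝ)) - n i := by
    intro i
    have : Nontrivial (Fin s) := Fin.nontrivial_iff_two_le.2 hs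
    obtain ⟨k, hk⟩ := exists_ne i
    rw [sub_pos]
    refine Finset.single_lt_sum (f := fun j => (n j : ℝ)) hk (Finset.mem_univ i) (Finset.mem_univ k) ?_ fun _ _ _ => by
      positivity
    exact Nat.cast_pos.2 (hn k)
  obtain ⟨v, hv⟩ := p.exists_rep
  rw [h]
  refine Finset.sum_pos' (fun i _ => mul_nonneg (hlt i).le (by positivity))
    ⟨v.1, Finset.mem_univ _, mul_pos (hlt _) ?_⟩
  rw [Nat.cast_pos, partCount, Set.ncard_pos]
  exact ⟨v, rfl, hv⟩

theorem hasDerivAt_matZ [Fintype F.ConnectedComponent] (h : ∀ p, alpha F p ≠ 0) (i j : Fin s) :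
    HasDerivAt (fun x => matZ F x i j) (matrixDeriv (matZ F) 0 i j) 0 := by
  have : DifferentiableAt ℝ (fun x => matZ F x i j) 0 := by
    simp only [matZ, matY, Matrix.add_apply, Matrix.of_apply]
    refine (differentiableAt_const _).add (DifferentiableAt.fun_sum fun p _ => ?_)
    exact (differentiableAt_const _).div (by fun_prop) (by simpa using h p)
  exact this.hasDerivAt

/-- The characteristic determinant of the contracted Laplacian, reduced to an `s × s`
determinant. -/
theorem det_eq_prod_mul_det_matZ [Fintype F.ConnectedComponent]
    [DecidableEq F.ConnectedComponent] {x : ℝ} (hx : ∀ p, x - alpha F p ≠ 0) :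
    (Matrix.scalar _ x - (Matrix.diagonal (alpha F) -
      (Matrix.of fun (p : F.ConnectedComponent) (j : Fin s) => (partCount F j p : ℝ)) *
      (Matrix.of fun (i : Fin s) (p : F.ConnectedComponent) =>
        (compOrder F p : ℝ) - (partCount F i p : ℝ)))).det =
    (∏ p, (x - alpha F p)) * (matZ F x).det := by
  set A := Matrix.of fun (p : F.ConnectedComponent) (j : Fin s) => (partCount F j p : ℝ) with hA
  set B := Matrix.of fun (i : Fin s) (p : F.ConnectedComponent) =>
        (compOrder F p : ℝ) - (partCount F i p : ℝ) with hB
  have h1 : Matrix.scalar _ x - (Matrix.diagonal (alpha F) - A * B) =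
      Matrix.diagonal (fun p => x - alpha F p) *
        (1 + (Matrix.diagonal (fun p => (x - alpha F p)⁻¹) * A) * B) := by
    rw [mul_add, mul_one, Matrix.mul_assoc, ← Matrix.mul_assoc, Matrix.diagonal_mul_diagonal]
    simp only [mul_inv_cancel₀ (hx _), Matrix.diagonal_one, one_mul, Matrix.scalar_apply]
    rw [← sub_add, Matrix.diagonal_sub]
  -- `det_one_add_mul_comm` passes from size `c` to size `s`.
  rw [h1, Matrix.det_mul, Matrix.det_diagonal, Matrix.det_one_add_mul_comm]
  congr 2
  ext i j
  rw [matZ, matY, Matrix.add_apply, Matrix.add_apply, Matrix.mul_apply]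
  simp only [Matrix.diagonal_mul, hA, hB, Matrix.of_apply]
  congr 1
  refine Finset.sum_congr rfl fun p _ => ?_
  ring

end MultipartiteForest

/-! ### Comparison of the two derivatives at `0` -/

open SimpleGraph MultipartiteForest in
theorem mainTheorem3 (s : ℕ) (hs : 2 ≤ s) (n : Fin s → ℕ) (hn : ∀ i, 1 ≤ n i)
    (F : SimpleGraph (MVert n)) (hF : F ≤ multipartite n) (hF' : F.IsAcyclic)
    [Fintype F.ConnectedComponent] :
    (∀ p : F.ConnectedComponent, MultipartiteForest.alpha F p ≠ 0) ∧
    (∀ i j : Fin s, DifferentiableAt ℝ (fun x : ℝ => MultipartiteForest.matZ F x i j) 0) ∧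
    (tauContaining (multipartite n) F : ℝ) =
      1 / (Fintype.card F.ConnectedComponent : ℝ) *
        (∏ p : F.ConnectedComponent, MultipartiteForest.alpha F p) *
        Matrix.trace (-(Matrix.adjugate (MultipartiteForest.matZ F 0)) *
          matrixDeriv (MultipartiteForest.matZ F) 0) := by
  classical
  have hα : ∀ p, alpha F p ≠ 0 := fun p => (alpha_pos F hs hn p).ne'
  refine ⟨hα, fun i j => (hasDerivAt_matZ F hα i j).differentiableAt, ?_⟩
  set N := contractedIncMatrix F (multipartite n)
  set L : Matrix F.ConnectedComponent F.ConnectedComponent ℝ :=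
    (N * N.transpose).map (Int.cast : ℤ → ℝ) with hL
  have hNe : Nonempty (MVert n) := ⟨⟨⟨0, by omega⟩, ⟨0, hn _⟩⟩⟩
  have hchar : ∀ x : ℝ, (∀ p, x - alpha F p ≠ 0) →
      (Matrix.scalar _ x - L).det = (∏ p, (x - alpha F p)) * (matZ F x).det := by
    intro x hx
    rw [hL, contracted_laplacian_eq F hF, det_eq_prod_mul_det_matZ F hx]
  have h0 : ∀ p, (0 : ℝ) - alpha F p ≠ 0 := fun p => by simpa using hα p
  have hLdet : L.det = 0 := by
    have : L.det = ((N * N.transpose).det : ℝ) := ((Int.castRingHom ℝ).map_det _).symm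
    rw [this, det_contractedIncMatrix_mul_transpose, Int.cast_zero]
  have hZdet : (matZ F 0).det = 0 := by
    have h := hchar 0 h0
    rw [map_zero, zero_sub, Matrix.det_neg, hLdet, mul_zero] at h
    exact (mul_eq_zero.1 h.symm).resolve_left (Finset.prod_ne_zero_iff.2 fun p _ => h0 p)
  -- The sign comes from negating a minor of order `c - 1`.
  have hadj : ∀ p, (-L).adjugate p p = (-1) ^ (Fintype.card F.ConnectedComponent - 1) *
      (tauContaining (multipartite n) F : ℝ) := by
    intro p
    rw [Matrix.adjugate_diag_eq_det_submatrix]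
    have h := congrArg (Int.cast : ℤ → ℝ) (det_contracted_laplacian hF hF' p)
    rw [Int.cast_natCast] at h
    have h1 : (((N * N.transpose).submatrix (Subtype.val : {q // q ≠ p} → _) Subtype.val).det : ℝ)
        = (L.submatrix (Subtype.val : {q // q ≠ p} → _) Subtype.val).det :=
      (Int.castRingHom ℝ).map_det _
    rw [Matrix.submatrix_neg, Pi.neg_apply, Pi.neg_apply, Matrix.det_neg, ← h1, h,
      Fintype.card_subtype_compl, Fintype.card_subtype_eq]
  have hd1 : HasDerivAt (fun x : ℝ => (Matrix.scalar _ x - L).det)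
      (∑ p, (-L).adjugate p p) 0 := by
    have h := Matrix.hasDerivAt_det (A := fun x : ℝ => Matrix.scalar _ x - L) (A' := 1) (x := 0)
      fun p q => by
        simp only [Matrix.sub_apply, Matrix.scalar_apply, Matrix.diagonal_apply, Matrix.one_apply]
        split_ifs
        · exact (hasDerivAt_id' 0).sub_const _
        · exact hasDerivAt_const _ _
    simpa [Matrix.trace] using h
  have hd2 : HasDerivAt (fun x : ℝ => (∏ p, (x - alpha F p)) * (matZ F x).det)
      ((∏ p, (0 - alpha F p)) *
        Matrix.trace ((matZ F 0).adjugate * matrixDeriv (matZ F) 0)) 0 := by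
    have hp : DifferentiableAt ℝ (fun x : ℝ => ∏ p, (x - alpha F p)) 0 := by fun_prop
    have h := hp.hasDerivAt.mul (Matrix.hasDerivAt_det (hasDerivAt_matZ F hα))
    -- The other term of the product rule carries the factor `det Z(0) = 0`.
    rw [hZdet, mul_zero, zero_add] at h
    exact h
  -- The factorization needs `x` to avoid every `α_p`, which holds near `0` since there are finitely
  -- many, all nonzero.
  have hev : (fun x : ℝ => (Matrix.scalar _ x - L).det) =ᶠ[nhds 0]
      fun x : ℝ => (∏ p, (x - alpha F p)) * (matZ F x).det := by
    have : ∀ᶠ x in nhds (0 : ℝ), ∀ p, x - alpha F p ≠ 0 :=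
      Filter.eventually_all.2 fun p =>
        ContinuousAt.eventually_ne (by fun_prop) (h0 p)
    exact this.mono hchar
  have heq := hd1.unique (hd2.congr_of_eventuallyEq hev)
  have hc : 0 < Fintype.card F.ConnectedComponent :=
    Fintype.card_pos_iff.2 ⟨F.connectedComponentMk hNe.some⟩
  obtain ⟨c, hcc⟩ : ∃ c, Fintype.card F.ConnectedComponent = c + 1 :=
    ⟨_, (Nat.sub_add_cancel hc).symm⟩
  have hprod : ∏ p, (0 - alpha F p) = (-1) ^ (c + 1) * ∏ p, alpha F p := by
    simp only [zero_sub, Finset.prod_neg, Finset.card_univ, hcc]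
  simp only [hadj, Finset.sum_const, Finset.card_univ, hcc, nsmul_eq_mul, hprod,
    Nat.add_sub_cancel] at heq
  rw [hcc, neg_mul, Matrix.trace_neg]
  have hc0 : ((c + 1 : ℕ) : ℝ) ≠ 0 := by positivity
  have hs1 : ((-1 : ℝ) ^ c) ≠ 0 := pow_ne_zero _ (by norm_num)
  rw [pow_succ] at heq
  field_simp
  refine mul_left_cancel₀ hs1 ?_
  linear_combination heq
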